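/- All graphs are finite and simple, and considered up to isomorphism. A graph $G$ is \emph{$k$-critical} if $\chi(G)=k$ and no proper induced subgraph of $G$ has chromatic number $k$. A graph is \emph{$(P_5,\overline{P}_5)$-free} if it has no induced subgraph isomorphic to the path $P_5$ on five vertices or to its complement $\overline{P}_5$. Let $\mathcal{C}_k$ denote the class of $k$-critical $(P_5,\overline{P}_5)$-free graphs. The \emph{join} of two graphs is their disjoint union together with all edges between them. The \emph{buoy with bags} $B_1,\dots,B_5$ is the graph obtained from the cycle $C_5$ with vertices $1,\dots,5$ in cyclic order by substituting the graph $B_i$ for each vertex $i$: it is the disjoint union of $B_1,\dots,B_5$ together with all edges between $B_i$ and $B_{i+1}$ for each $i$, with indices modulo $5$. \textbf{Theorem.} Let $k\ge 2$ be an integer. A graph $G$ belongs to $\mathcal{C}_k$ if and only if at least one of the following holds. (1) There are positive integers $k_1,k_2$ with $k_1+k_2=k$ such that $G$ is the join of a member of $\mathcal{C}_{k_1}$ and a member of $\mathcal{C}_{k_2}$. (2) There are positive integers $k_1,\dots,k_5$ with $k_i+k_{i+1}\le k-1$ for each $i$ (indices modulo $5$) and $\sum_{i=1}^5 k_i=2k-1$,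 such that $G$ is a buoy with bags $B_1,\dots,B_5$ where $B_i$ is a member of $\mathcal{C}_{k_i}$ for each $i$. -/

import Mathlib

universe u v

namespace SimpleGraph

/-- `G` is `k`-critical: it has chromatic number `k`, and no proper induced subgraph of `G` has
chromatic number `k`. -/
def IsCritical {V : Type u} (G : SimpleGraph V) (k : ℕ) : Prop :=
  G.chromaticNumber = (k : ℕ∞) ∧
    ∀ S : Set V, S ≠ Set.univ → (G.induce S).chromaticNumber ≠ (k : ℕ∞)

/-- `G` has no induced subgraph isomorphic to the path `P₅` on five vertices, nor to its
complement. -/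
def IsP5CoP5Free {V : Type u} (G : SimpleGraph V) : Prop :=
  ¬ (pathGraph 5).IsIndContained G ∧ ¬ (pathGraph 5)ᶜ.IsIndContained G

/-- Membership in the family `𝒞 k` of `k`-critical `(P₅, co-P₅)`-free graphs. -/
def MemC {V : Type u} (G : SimpleGraph V) (k : ℕ) : Prop :=
  G.IsCritical k ∧ G.IsP5CoP5Free

/-- The join of two graphs: their disjoint union together with all edges between them. -/
def joinGraph {V : Type u} {W : Type v} (G : SimpleGraph V) (H : SimpleGraph W) :
    SimpleGraph (V ⊕ W) where
  Adj
    | Sum.inl a, Sum.inl b => G.Adj a b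
    | Sum.inr a, Sum.inr b => H.Adj a b
    | Sum.inl _, Sum.inr _ => True
    | Sum.inr _, Sum.inl _ => True
  symm := ⟨by
    rintro (a | a) (b | b) h
    · exact G.adj_symm h
    · trivial
    · trivial
    · exact H.adj_symm h⟩
  loopless := ⟨by
    rintro (a | a) h
    · exact G.irrefl h
    · exact H.irrefl h⟩

/-- The graph obtained from `G` by substituting, for every vertex `i` of `G`, the graph `B i`:
vertices of one `B i` are adjacent as in `B i`, and a vertex of `B i` is adjacent to a vertex of
`B j`, for `i ≠ j`, exactly when `i` and `j` are adjacent in `G`. -/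
def substitute {ι : Type v} (G : SimpleGraph ι) {W : ι → Type u} (B : ∀ i, SimpleGraph (W i)) :
    SimpleGraph (Σ i, W i) where
  Adj x y := G.Adj x.1 y.1 ∨ ∃ (i : ι) (a b : W i), x = ⟨i, a⟩ ∧ y = ⟨i, b⟩ ∧ (B i).Adj a b
  symm := ⟨by
    rintro x y (h | ⟨i, a, b, rfl, rfl, h⟩)
    · exact Or.inl h.symm
    · exact Or.inr ⟨i, b, a, rfl, rfl, h.symm⟩⟩
  loopless := ⟨by
    rintro x (h | ⟨i, a, b, h₁, h₂, h⟩)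
    · exact G.irrefl h
    · obtain rfl : a = b := by
        have := h₁.symm.trans h₂
        simpa using this
      exact (B i).irrefl h⟩

/-- The buoy with bags `B 0, …, B 4`, in this cyclic order. -/
def buoy {W : Fin 5 → Type u} (B : ∀ i, SimpleGraph (W i)) : SimpleGraph (Σ i, W i) :=
  (cycleGraph 5).substitute B

/-- `G` is (isomorphic to) the join of a member of `𝒞 k₁` and a member of `𝒞 k₂`, where `k₁` and
`k₂` are positive integers with `k₁ + k₂ = k`. -/
def IsConstruction1 {V : Type u} (G : SimpleGraph V) (k : ℕ) : Prop :=
  ∃ (k₁ k₂ : ℕ) (V₁ V₂ : Type u) (G₁ : SimpleGraph V₁) (G₂ : SimpleGraph V₂),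
    0 < k₁ ∧ 0 < k₂ ∧ k₁ + k₂ = k ∧ G₁.MemC k₁ ∧ G₂.MemC k₂ ∧
      Nonempty (G ≃g G₁.joinGraph G₂)

/-- `G` is (isomorphic to) a buoy whose bags `B i` are members of `𝒞 (κ i)` for positive integers
`κ i` satisfying the stated constraints; `i + 1` is addition modulo `5`. -/
def IsConstruction2 {V : Type u} (G : SimpleGraph V) (k : ℕ) : Prop :=
  ∃ (κ : Fin 5 → ℕ) (W : Fin 5 → Type u) (B : ∀ i, SimpleGraph (W i)),
    (∀ i, 0 < κ i) ∧ (∀ i, κ i + κ (i + 1) ≤ k - 1) ∧ ∑ i, κ i = 2 * k - 1 ∧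
      (∀ i, (B i).MemC (κ i)) ∧ Nonempty (G ≃g buoy B)

end SimpleGraph

namespace SimpleGraph

/-! ### Criticality in terms of colorability -/

/-! Colorings respect modules. If the vertex set of `G` splits into modules with quotient `Q`, then
`G` is `n`-colorable exactly when `Q` has a weighted `n`-coloring whose weights are the chromatic
numbers of the modules. Hence `G` is critical iff every module is critical and the weight is
critical on `Q` (`IsModularMap.isCritical_iff`). On `K₂` and `C₅`, weight criticality is the
arithmetic in the two constructions. Induced copies of the prime graphs `P₅` and co-`P₅` lie in a
module or embed in the quotient, so forbidding them also passes through. This gives the "if"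
direction.

For the converse, a modular partition into the fewest parts, at least two, has a prime quotient `Q`.
If `Q` contains an induced `C₅`, a largest buoy in `Q` is all of `Q`: a vertex mixed on it would fit
into a bag, by the absence of `P₅` and co-`P₅`. So `G` is a buoy.

If `Q` has no induced `C₅`, ordering its vertices by decreasing degree is a perfect order in
Chvátal's sense, so greedy coloring is optimal and, after blowing vertices up to cliques, the
weighted chromatic number is the largest weight of a clique. A vertex outside a heaviest clique
could lose weight without saving a color; hence a critical weight forces `Q` to be complete, and `G`
is a join. -/

theorem exists_minimal_colorable {V : Type*} [Finite V] (G : SimpleGraph V) :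
    ∃ m, G.Colorable m ∧ ∀ n, G.Colorable n → m ≤ n := by
  classical
  have := Fintype.ofFinite V
  have h : ∃ m, G.Colorable m := ⟨_, G.colorable_of_fintype⟩
  exact ⟨Nat.find h, Nat.find_spec h, fun n hn => Nat.find_min' h hn⟩

theorem Colorable.of_induce_compl_singleton {V : Type*} {G : SimpleGraph V} {v : V} {m : ℕ}
    (h : (G.induce {v}ᶜ).Colorable m) : G.Colorable (m + 1) := by
  classical
  obtain ⟨c⟩ := h
  let C : G.Coloring (Option (Fin m)) := Coloring.mk
    (fun w => if hw : w = v then none else some (c ⟨w, hw⟩)) (by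
      intro a b hab
      by_cases ha : a = v
      · by_cases hb : b = v
        · exact absurd (ha.trans hb.symm) hab.ne
        · simp [ha, hb]
      · by_cases hb : b = v
        · simp [ha, hb]
        · simpa [ha, hb] using c.valid (show (G.induce {v}ᶜ).Adj ⟨a, ha⟩ ⟨b, hb⟩ from hab))
  simpa using C.colorable

/-- Colorability is monotone under induced subgraphs, so deleting single vertices suffices.
Positivity of `k` makes `k - 1` a true predecessor. -/
theorem isCritical_iff_colorable {V : Type*} {G : SimpleGraph V} {k : ℕ} (hk : 0 < k) :
    G.IsCritical k ↔ G.Colorable k ∧ (∀ n, G.Colorable n → k ≤ n) ∧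
      ∀ v, (G.induce {v}ᶜ).Colorable (k - 1) := by
  constructor
  · rintro ⟨h, hS⟩
    refine ⟨chromaticNumber_le_iff_colorable.1 h.le, fun n hn => ?_, fun v => ?_⟩
    · have := hn.chromaticNumber_le
      rw [h] at this
      exact_mod_cast this
    · have h1 : (G.induce {v}ᶜ).chromaticNumber ≤ k :=
        chromaticNumber_le_iff_colorable.2
          ((chromaticNumber_le_iff_colorable.1 h.le).of_hom (Embedding.induce _).toHom)
      have h2 := lt_of_le_of_ne h1 (hS {v}ᶜ (by simp))
      obtain ⟨m, hm⟩ := ENat.ne_top_iff_exists.1 h2.ne_top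
      rw [← hm] at h2
      have h3 : m < k := by exact_mod_cast h2
      exact (chromaticNumber_le_iff_colorable.1 hm.symm.le).mono (by omega)
  · rintro ⟨h, hmin, hv⟩
    refine ⟨le_antisymm (chromaticNumber_le_iff_colorable.2 h)
      (le_chromaticNumber_iff_colorable.2 fun m hm => by exact_mod_cast hmin m hm), ?_⟩
    intro S hS heq
    obtain ⟨v, hvS⟩ := (Set.ne_univ_iff_exists_notMem S).1 hS
    have h1 : (G.induce S).Colorable (k - 1) :=
      (hv v).of_hom (G.induceHomOfLE (s := S) (s' := {v}ᶜ) (by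
        intro x hx hxv
        exact hvS (hxv ▸ hx))).toHom
    have h2 := h1.chromaticNumber_le
    rw [heq] at h2
    have : k ≤ k - 1 := by exact_mod_cast h2
    omega

/-! ### Weighted colorings and modular maps -/

/-- Every vertex `i` can be given at least `κ i` of `n` colors, so that adjacent vertices share no
color. -/
def WeightColorable {I : Type*} (Q : SimpleGraph I) (κ : I → ℕ) (n : ℕ) : Prop :=
  ∃ C : I → Finset (Fin n), (∀ i, κ i ≤ (C i).card) ∧ ∀ i j, Q.Adj i j → Disjoint (C i) (C j)

theorem WeightColorable.mono_weight {I : Type*} {Q : SimpleGraph I} {κ μ : I → ℕ} {n : ℕ}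
    (h : Q.WeightColorable κ n) (hμ : ∀ i, μ i ≤ κ i) : Q.WeightColorable μ n := by
  obtain ⟨C, hC, hd⟩ := h
  exact ⟨C, fun i => (hμ i).trans (hC i), hd⟩

/-- The weight `κ` on `Q` needs exactly `k` colors, and decreasing any weight saves a color. -/
def WeightCritical {I : Type*} [DecidableEq I] (Q : SimpleGraph I) (κ : I → ℕ) (k : ℕ) : Prop :=
  Q.WeightColorable κ k ∧ (∀ n, Q.WeightColorable κ n → k ≤ n) ∧
    ∀ i, Q.WeightColorable (Function.update κ i (κ i - 1)) (k - 1)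

/-- The fibers of `f` are modules of `G`, with quotient graph `Q`. -/
def IsModularMap {V I : Type*} (G : SimpleGraph V) (Q : SimpleGraph I) (f : V → I) : Prop :=
  ∀ ⦃u v⦄, f u ≠ f v → (G.Adj u v ↔ Q.Adj (f u) (f v))

/-- The subgraph of `G` induced by a fiber of `f`. -/
abbrev fiber {V I : Type*} (G : SimpleGraph V) (f : V → I) (i : I) : SimpleGraph (f ⁻¹' {i}) :=
  G.induce (f ⁻¹' {i})

namespace IsModularMap

variable {V I : Type*} {G : SimpleGraph V} {Q : SimpleGraph I} {f : V → I}

theorem comp {J : Type*} {R : SimpleGraph J} {g : I → J} (hg : Q.IsModularMap R g)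
    (hf : G.IsModularMap Q f) : G.IsModularMap R (g ∘ f) := fun _ _ h =>
  (hf fun e => h (congrArg g e)).trans (hg h)

theorem restrict (hf : G.IsModularMap Q f) (S : Set V) :
    (G.induce S).IsModularMap Q (fun v => f v) := fun _ _ h => hf h

/-- Each fiber is colored from its own palette `C i`; edges between fibers join only disjoint
palettes. -/
theorem colorable (hf : G.IsModularMap Q f) {κ : I → ℕ} {n : ℕ}
    (hκ : ∀ i, (G.fiber f i).Colorable (κ i)) (h : Q.WeightColorable κ n) : G.Colorable n := by
  obtain ⟨C, hC, hd⟩ := h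
  have c : ∀ i, (G.fiber f i).Coloring (C i) := fun i => (hκ i).toColoring (by simpa using hC i)
  refine ⟨Coloring.mk (fun v => (c (f v) ⟨v, rfl⟩ : Fin n)) ?_⟩
  intro u v huv
  by_cases h : f u = f v
  · intro e
    -- `c (f u)` and `c (f v)` have different types, so the index is generalized before they are
    -- compared.
    have key : ∀ i (hu : f u = i) (hv : f v = i),
        ((c i ⟨u, hu⟩ : C i) : Fin n) ≠ (c i ⟨v, hv⟩ : C i) := fun i hu hv e =>
      (c i).valid (show (G.fiber f i).Adj ⟨u, hu⟩ ⟨v, hv⟩ from huv) (Subtype.ext e)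
    have hcong : ∀ i j (hij : i = j) (hi : f v = i) (hj : f v = j),
        ((c i ⟨v, hi⟩ : C i) : Fin n) = (c j ⟨v, hj⟩ : C j) := by
      rintro i _ rfl _ _
      rfl
    exact key (f u) rfl h.symm (e.trans (hcong _ _ h.symm rfl h.symm))
  · exact Finset.disjoint_left.1 (hd _ _ ((hf h).1 huv)) (c (f u) ⟨u, rfl⟩).2 |> fun hn e =>
      hn (by rw [e]; exact (c (f v) ⟨v, rfl⟩).2)

/-- The palette of `i` is the set of colors that appear on its fiber. -/
theorem weightColorable (hf : G.IsModularMap Q f) {κ : I → ℕ} {n : ℕ}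
    (hκ : ∀ i m, (G.fiber f i).Colorable m → κ i ≤ m) (h : G.Colorable n) :
    Q.WeightColorable κ n := by
  classical
  obtain ⟨c⟩ := h
  refine ⟨fun i => Finset.univ.filter fun a => ∃ v, f v = i ∧ c v = a, fun i => ?_, ?_⟩
  · refine hκ i _ ?_
    have C : (G.fiber f i).Coloring
        (Finset.univ.filter fun a => ∃ v, f v = i ∧ c v = a : Finset (Fin n)) :=
      Coloring.mk (fun v => ⟨c v, by simpa using ⟨v.1, v.2, rfl⟩⟩) (by
        intro a b hab e
        exact c.valid (show G.Adj a b from hab) (congrArg Subtype.val e))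
    exact C.colorable.mono (Fintype.card_coe _).le
  · intro i j hij
    rw [Finset.disjoint_left]
    intro a ha hb
    simp only [Finset.mem_filter, Finset.mem_univ, true_and] at ha hb
    obtain ⟨u, rfl, hu⟩ := ha
    obtain ⟨v, rfl, hv⟩ := hb
    exact c.valid ((hf hij.ne).2 hij) (hu.trans hv.symm)

/-- A fiber of the map that `f` induces on `G - v`, when it does not contain `v`. -/
theorem colorable_fiber_of_ne {v : V} {i : I} (hi : f v ≠ i) {m : ℕ} :
    ((G.induce {v}ᶜ).fiber (fun w => f w) i).Colorable m ↔ (G.fiber f i).Colorable m := by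
  constructor
  · have hne : ∀ w : f ⁻¹' {i}, w.1 ∈ ({v}ᶜ : Set V) := fun w e =>
      hi ((congrArg f (show w.1 = v from e)).symm.trans w.2)
    exact fun h => h.of_hom ⟨fun w => ⟨⟨w.1, hne w⟩, w.2⟩, fun h => h⟩
  · exact fun h => h.of_hom ⟨fun w => ⟨w.1.1, w.2⟩, fun h => h⟩

/-- The fiber containing `v` of the map that `f` induces on `G - v`. -/
theorem colorable_fiber_self {v : V} {m : ℕ} :
    ((G.induce {v}ᶜ).fiber (fun w => f w) (f v)).Colorable m ↔
      ((G.fiber f (f v)).induce {⟨v, rfl⟩}ᶜ).Colorable m := by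
  constructor
  · exact fun h => h.of_hom
      ⟨fun w => ⟨⟨w.1.1, fun e => w.2 (Subtype.ext e)⟩, w.1.2⟩, fun h => h⟩
  · exact fun h => h.of_hom
      ⟨fun w => ⟨⟨w.1.1, w.2⟩, fun e => w.1.2 (congrArg Subtype.val e)⟩, fun h => h⟩

theorem isCritical_iff [Finite V] [DecidableEq I] (hf : G.IsModularMap Q f)
    (hs : Function.Surjective f) {k : ℕ} (hk : 0 < k) :
    G.IsCritical k ↔ ∃ κ : I → ℕ, (∀ i, 0 < κ i) ∧ (∀ i, (G.fiber f i).IsCritical (κ i)) ∧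
      Q.WeightCritical κ k := by
  rw [isCritical_iff_colorable hk]
  constructor
  · rintro ⟨hc, hmin, hv⟩
    choose κ hκ hκmin using fun i => (G.fiber f i).exists_minimal_colorable
    have hpos : ∀ i, 0 < κ i := by
      intro i
      obtain ⟨v, hv⟩ := hs i
      rw [Nat.pos_iff_ne_zero]
      intro h0
      have := hκ i
      rw [h0, colorable_zero_iff] at this
      exact this.elim ⟨v, hv⟩
    refine ⟨κ, hpos, fun i => (isCritical_iff_colorable (hpos i)).2 ⟨hκ i, hκmin i, ?_⟩,
      hf.weightColorable hκmin hc, fun n hn => hmin n (hf.colorable hκ hn), fun i => ?_⟩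
    · rintro ⟨v, rfl⟩
      choose μ hμ hμmin using
        fun i => ((G.induce {v}ᶜ).fiber (fun w => f w) i).exists_minimal_colorable
      have hw := (hf.restrict {v}ᶜ).weightColorable hμmin (hv v)
      -- If deleting `v` did not lower the chromatic number of its fiber, the weight `κ` would
      -- already fit into `k - 1` colors.
      by_cases hlt : μ (f v) < κ (f v)
      · exact (colorable_fiber_self.1 (hμ (f v))).mono (by omega)
      · exfalso
        have hw' : Q.WeightColorable κ (k - 1) := hw.mono_weight fun i => by
          by_cases hi : f v = i
          · subst hi
            omega
          · exact hκmin i _ ((colorable_fiber_of_ne hi).1 (hμ i))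
        have := hmin _ (hf.colorable hκ hw')
        omega
    · obtain ⟨v, rfl⟩ := hs i
      refine (hf.restrict {v}ᶜ).weightColorable (fun j m hm => ?_) (hv v)
      by_cases hj : f v = j
      · subst hj
        have := hκmin _ _ (colorable_fiber_self.1 hm).of_induce_compl_singleton
        simp only [Function.update_self]
        omega
      · rw [Function.update_of_ne (Ne.symm hj)]
        exact hκmin j m ((colorable_fiber_of_ne hj).1 hm)
  · rintro ⟨κ, hpos, hcrit, hk1, hk2, hk3⟩
    have hcrit' := fun i => (isCritical_iff_colorable (hpos i)).1 (hcrit i)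
    refine ⟨hf.colorable (fun i => (hcrit' i).1) hk1,
      fun n hn => hk2 n (hf.weightColorable (fun i => (hcrit' i).2.1) hn), fun v => ?_⟩
    refine (hf.restrict {v}ᶜ).colorable (fun j => ?_) (hk3 (f v))
    by_cases hj : f v = j
    · subst hj
      simp only [Function.update_self]
      exact colorable_fiber_self.2 ((hcrit' _).2.2 _)
    · rw [Function.update_of_ne (Ne.symm hj)]
      exact (colorable_fiber_of_ne hj).2 (hcrit' j).1

end IsModularMap

/-! ### Weighted colorings of cliques and of the cycle of length five -/

theorem WeightColorable.sum_le_of_isClique {I : Type*} {Q : SimpleGraph I} {κ : I → ℕ} {n : ℕ}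
    (h : Q.WeightColorable κ n) {T : Finset I} (hT : Q.IsClique T) : ∑ i ∈ T, κ i ≤ n := by
  classical
  obtain ⟨C, hC, hd⟩ := h
  calc ∑ i ∈ T, κ i ≤ ∑ i ∈ T, (C i).card := Finset.sum_le_sum fun i _ => hC i
    _ = (T.biUnion C).card := (Finset.card_biUnion fun i hi j hj hij => hd i j (hT hi hj hij)).symm
    _ ≤ n := by simpa using Finset.card_le_univ (T.biUnion C)

theorem weightColorable_top_bool_iff {κ : Bool → ℕ} {n : ℕ} :
    (⊤ : SimpleGraph Bool).WeightColorable κ n ↔ κ true + κ false ≤ n := by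
  constructor
  · intro h
    simpa using h.sum_le_of_isClique (T := Finset.univ) (by intro a _ b _ hab; simpa using hab)
  · intro h
    obtain ⟨A, -, hA⟩ := Finset.exists_subset_card_eq
      (show κ true ≤ (Finset.univ : Finset (Fin n)).card by simp; omega)
    refine ⟨fun b => cond b A Aᶜ, ?_, ?_⟩
    · rintro (_ | _)
      · simp [Finset.card_compl, hA]; omega
      · simp [hA]
    · rintro (_ | _) (_ | _) hij
      · simp at hij
      · exact disjoint_compl_left
      · exact disjoint_compl_right
      · simp at hij

theorem weightCritical_top_bool_iff {κ : Bool → ℕ} {k : ℕ} (hκ : ∀ b, 0 < κ b) :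
    (⊤ : SimpleGraph Bool).WeightCritical κ k ↔ κ true + κ false = k := by
  have h1 := hκ true
  have h2 := hκ false
  simp only [WeightCritical, weightColorable_top_bool_iff, Bool.forall_bool, Function.update_self]
  simp only [ne_eq, reduceCtorEq, not_false_eq_true, Function.update_of_ne]
  constructor
  · rintro ⟨h, h', -⟩
    exact le_antisymm h (h' _ le_rfl)
  · rintro rfl
    exact ⟨le_rfl, fun n h => h, by omega, by omega⟩

/-- Hall's condition for two sets: `X` takes as much as possible from `A \ B`, where it cannot
obstruct `Y`. -/
theorem exists_disjoint_subsets_card_eq {α : Type*} [DecidableEq α] {A B : Finset α} {a b : ℕ}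
    (ha : a ≤ A.card) (hb : b ≤ B.card) (hab : a + b ≤ (A ∪ B).card) :
    ∃ X ⊆ A, ∃ Y ⊆ B, X.card = a ∧ Y.card = b ∧ Disjoint X Y := by
  by_cases h : a ≤ (A \ B).card
  · obtain ⟨X, hX, hXc⟩ := Finset.exists_subset_card_eq h
    obtain ⟨Y, hY, hYc⟩ := Finset.exists_subset_card_eq hb
    exact ⟨X, hX.trans Finset.sdiff_subset, Y, hY, hXc, hYc,
      Finset.disjoint_of_subset_left hX (Finset.disjoint_of_subset_right hY Finset.sdiff_disjoint)⟩
  · obtain ⟨X, hX1, hX2, hXc⟩ :=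
      Finset.exists_subsuperset_card_eq (Finset.sdiff_subset (s := A) (t := B)) (by omega) ha
    have hcard : b ≤ ((A ∪ B) \ X).card := by
      rw [Finset.card_sdiff_of_subset (hX2.trans Finset.subset_union_left)]
      omega
    obtain ⟨Y, hY, hYc⟩ := Finset.exists_subset_card_eq hcard
    refine ⟨X, hX2, Y, fun y hy => ?_, hXc, hYc, ?_⟩
    · have := hY hy
      simp only [Finset.mem_sdiff, Finset.mem_union] at this
      by_contra hyB
      exact this.2 (hX1 (Finset.mem_sdiff.2 ⟨this.1.resolve_right hyB, hyB⟩))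
    · exact Finset.disjoint_of_subset_right hY Finset.disjoint_sdiff

/-- Necessity: adjacent palettes are disjoint, and a color occurs on at most two vertices of `C₅`.
Sufficiency: the two neighbors of vertex `0` get palettes `B`, `E` that overlap as little as
possible. The other two vertices then need disjoint sets in `Bᶜ` and `Eᶜ`, and the sum condition
provides the room. -/
theorem weightColorable_cycleGraph_five_iff {κ : Fin 5 → ℕ} {n : ℕ} :
    (cycleGraph 5).WeightColorable κ n ↔ (∀ i, κ i + κ (i + 1) ≤ n) ∧ ∑ i, κ i ≤ 2 * n := by
  classical
  constructor
  · intro h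
    refine ⟨fun i => ?_, ?_⟩
    · have hne : i ≠ i + 1 := by revert i; decide
      have hadj : (cycleGraph 5).Adj i (i + 1) := by revert i; decide
      have := h.sum_le_of_isClique (T := {i, i + 1}) (by
        simpa [isClique_pair] using hadj)
      rwa [Finset.sum_pair hne] at this
    · obtain ⟨C, hC, hd⟩ := h
      calc ∑ i, κ i ≤ ∑ i, (C i).card := Finset.sum_le_sum fun i _ => hC i
        _ = ∑ i, ∑ a : Fin n, if a ∈ C i then 1 else 0 := by simp
        _ = ∑ a : Fin n, ∑ i, if a ∈ C i then 1 else 0 := Finset.sum_comm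
        _ ≤ ∑ _a : Fin n, 2 := by
          refine Finset.sum_le_sum fun a _ => ?_
          have hp : ∀ i, ¬ (a ∈ C i ∧ a ∈ C (i + 1)) := fun i h =>
            Finset.disjoint_left.1 (hd i (i + 1) (by clear h; revert i; decide)) h.1 h.2
          have h0 := hp 0
          have h1 := hp 1
          have h2 := hp 2
          have h3 := hp 3
          have h4 := hp 4
          simp only [Fin.isValue, Fin.reduceAdd, zero_add] at h0 h1 h2 h3 h4
          simp only [Fin.sum_univ_five]
          split_ifs <;> simp_all
        _ = 2 * n := by simp [mul_comm]
  · rintro ⟨hp, hs⟩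
    have h0 := hp 0
    have h1 := hp 1
    have h2 := hp 2
    have h3 := hp 3
    have h4 := hp 4
    simp only [Fin.isValue, Fin.reduceAdd, zero_add] at h0 h1 h2 h3 h4
    simp only [Fin.sum_univ_five] at hs
    obtain ⟨A, -, hA⟩ := Finset.exists_subset_card_eq
      (show κ 0 ≤ (Finset.univ : Finset (Fin n)).card by simp; omega)
    have hAc : Aᶜ.card = n - κ 0 := by simp [Finset.card_compl, hA]
    obtain ⟨B, hBA, hB⟩ := Finset.exists_subset_card_eq (show κ 1 ≤ Aᶜ.card by omega)
    -- `B` and `E` are disjoint if `Aᶜ` has room for both; otherwise they cover `Aᶜ`.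
    obtain ⟨E, hEA, hE, hBE⟩ : ∃ E ⊆ Aᶜ, E.card = κ 4 ∧
        min (n - κ 0) (κ 1 + κ 4) ≤ (B ∪ E).card := by
      have hc : (Aᶜ \ B).card = n - κ 0 - κ 1 := by
        rw [Finset.card_sdiff_of_subset hBA, hAc, hB]
      by_cases h : κ 4 ≤ (Aᶜ \ B).card
      · obtain ⟨E, hE, hEc⟩ := Finset.exists_subset_card_eq h
        refine ⟨E, hE.trans Finset.sdiff_subset, hEc, ?_⟩
        rw [Finset.card_union_of_disjoint (Finset.disjoint_of_subset_right hE
          Finset.disjoint_sdiff)]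
        omega
      · obtain ⟨E, hE1, hE2, hEc⟩ := Finset.exists_subsuperset_card_eq
          (Finset.sdiff_subset (s := Aᶜ) (t := B)) (by omega) (show κ 4 ≤ Aᶜ.card by omega)
        refine ⟨E, hE2, hEc, ?_⟩
        have : Aᶜ ⊆ B ∪ E := fun x hx => by
          by_cases hxB : x ∈ B
          · exact Finset.mem_union_left _ hxB
          · exact Finset.mem_union_right _ (hE1 (Finset.mem_sdiff.2 ⟨hx, hxB⟩))
        have := Finset.card_le_card this
        omega
    have hinter : (Bᶜ ∪ Eᶜ).card = n - (B ∩ E).card := by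
      rw [← Finset.compl_inter, Finset.card_compl, Fintype.card_fin]
    have hadd := Finset.card_union_add_card_inter B E
    obtain ⟨X, hX, Y, hY, hXc, hYc, hXY⟩ := exists_disjoint_subsets_card_eq
      (A := Bᶜ) (B := Eᶜ) (a := κ 2) (b := κ 3)
      (by rw [Finset.card_compl, Fintype.card_fin]; omega)
      (by rw [Finset.card_compl, Fintype.card_fin]; omega)
      (by rw [hinter]; omega)
    have dAB : Disjoint A B := Finset.disjoint_of_subset_right hBA disjoint_compl_right
    have dAE : Disjoint A E := Finset.disjoint_of_subset_right hEA disjoint_compl_right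
    have dBX : Disjoint B X := Finset.disjoint_of_subset_right hX disjoint_compl_right
    have dEY : Disjoint E Y := Finset.disjoint_of_subset_right hY disjoint_compl_right
    refine ⟨![A, B, X, Y, E], fun i => ?_, fun i j hij => ?_⟩
    · fin_cases i <;> simp [hA, hB, hXc, hYc, hE]
    · have hcases : j = i + 1 ∨ i = j + 1 := by
        revert i j
        decide
      have hstep : ∀ i : Fin 5, Disjoint (![A, B, X, Y, E] i) (![A, B, X, Y, E] (i + 1)) := by
        intro i
        fin_cases i
        exacts [dAB, dBX, hXY, dEY.symm, dAE.symm]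
      rcases hcases with rfl | rfl
      · exact hstep i
      · exact (hstep j).symm

theorem weightCritical_cycleGraph_five_iff {κ : Fin 5 → ℕ} {k : ℕ} (hk : 0 < k)
    (hκ : ∀ i, 0 < κ i) : (cycleGraph 5).WeightCritical κ k ↔
      (∀ i, κ i + κ (i + 1) ≤ k - 1) ∧ ∑ i, κ i = 2 * k - 1 := by
  have hsum : ∀ i, ∑ j, Function.update κ i (κ i - 1) j + 1 = ∑ j, κ j := by
    intro i
    rw [Finset.sum_update_of_mem (Finset.mem_univ i), ← Finset.add_sum_erase _ _ (Finset.mem_univ i),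
      Finset.sdiff_singleton_eq_erase]
    have := hκ i
    omega
  simp only [WeightCritical, weightColorable_cycleGraph_five_iff]
  constructor
  · rintro ⟨-, hmin, hdec⟩
    have hpair : ∀ i, κ i + κ (i + 1) ≤ k - 1 := by
      intro i
      -- Vertex `i + 3` is neither `i` nor `i + 1`, so lowering its weight leaves this pair
      -- untouched.
      have := (hdec (i + 3)).1 i
      rwa [Function.update_of_ne (by clear this; revert i; decide),
        Function.update_of_ne (by clear this; revert i; decide)] at this
    refine ⟨hpair, ?_⟩
    -- Lowering one weight gives a sum of at most `2 * k - 1`; a smaller sum would let `k - 1`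
    -- colors suffice.
    have h1 := (hdec 0).2
    have h2 := hsum 0
    by_contra hne
    have := hmin (k - 1) ⟨hpair, by omega⟩
    omega
  · rintro ⟨hpair, hs⟩
    refine ⟨⟨fun i => (hpair i).trans (by omega), by omega⟩, fun n hn => by omega, fun i =>
      ⟨fun j => le_trans (add_le_add ?_ ?_) (hpair j), ?_⟩⟩
    · by_cases h : j = i
      · subst h; simp
      · rw [Function.update_of_ne h]
    · by_cases h : j + 1 = i
      · subst h; simp
      · rw [Function.update_of_ne h]
    · have := hsum i
      omega

/-! ### Prime graphs on five vertices -/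

/-- `P` has no module other than the empty set, the singletons and the whole vertex set. -/
def IsPrimeGraph {α : Type*} [Fintype α] (P : SimpleGraph α) : Prop :=
  ∀ S : Finset α, 2 ≤ S.card → S ≠ Finset.univ →
    ∃ x, x ∉ S ∧ ∃ a ∈ S, ∃ b ∈ S, P.Adj x a ∧ ¬ P.Adj x b

theorem isPrimeGraph_cycleGraph_five : (cycleGraph 5).IsPrimeGraph := by
  unfold IsPrimeGraph
  decide

theorem isPrimeGraph_pathGraph_five : (pathGraph 5).IsPrimeGraph := by
  unfold IsPrimeGraph
  simp only [pathGraph_adj]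
  decide

theorem IsPrimeGraph.compl {α : Type*} [Fintype α] {P : SimpleGraph α} (hP : P.IsPrimeGraph) :
    Pᶜ.IsPrimeGraph := by
  intro S h2 hS
  obtain ⟨x, hx, a, ha, b, hb, hxa, hxb⟩ := hP S h2 hS
  refine ⟨x, hx, b, hb, a, ha, ?_, fun h => ((compl_adj _ _ _).1 h).2 hxa⟩
  exact (compl_adj _ _ _).2 ⟨fun e => hx (e ▸ hb), hxb⟩

/-- A map from a prime graph on at least three vertices that preserves and reflects adjacency is
injective. -/
theorem IsPrimeGraph.isIndContained {α V : Type*} [Fintype α] {P : SimpleGraph α}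
    (hP : P.IsPrimeGraph) (hα : 2 < Fintype.card α) {G : SimpleGraph V} (g : α → V)
    (hg : ∀ i j, G.Adj (g i) (g j) ↔ P.Adj i j) : P.IsIndContained G := by
  classical
  refine ⟨⟨⟨g, fun i j hij => ?_⟩, fun {i j} => hg i j⟩⟩
  by_contra hne
  obtain ⟨x, -, a, ha, b, hb, hxa, hxb⟩ := hP {i, j} (Finset.card_pair hne).ge (by
    intro h
    have := Finset.card_pair hne
    rw [h, Finset.card_univ] at this
    omega)
  have hgab : g a = g b := by
    simp only [Finset.mem_insert, Finset.mem_singleton] at ha hb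
    rcases ha with rfl | rfl <;> rcases hb with rfl | rfl <;> simp [hij]
  rw [← hg, hgab, hg] at hxa
  exact hxb hxa

/-- The fibers of `f` cut out modules of the copy of `P`. By primeness these are all trivial, or one
of them is everything. -/
theorem IsModularMap.isIndContained_or {α V I : Type*} [Fintype α] {P : SimpleGraph α}
    {G : SimpleGraph V} {Q : SimpleGraph I} {f : V → I} (hf : G.IsModularMap Q f)
    (hP : P.IsPrimeGraph) (h : P.IsIndContained G) :
    P.IsIndContained Q ∨ ∃ i, P.IsIndContained (G.fiber f i) := by
  classical
  obtain ⟨e⟩ := h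
  by_cases hinj : Function.Injective (f ∘ e)
  · left
    refine ⟨⟨⟨f ∘ e, hinj⟩, fun {a b} => ?_⟩⟩
    by_cases hab : a = b
    · subst hab; simp
    · exact (hf fun h => hab (hinj h)).symm.trans e.map_adj_iff
  · right
    simp only [Function.Injective, not_forall] at hinj
    obtain ⟨a, b, hab, hne⟩ := hinj
    set S : Finset α := Finset.univ.filter fun x => f (e x) = f (e a) with hSdef
    have hS : S = Finset.univ := by
      by_contra hS
      obtain ⟨x, hx, c, hc, d, hd, hxc, hxd⟩ := hP S (by
        rw [← Finset.card_pair hne]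
        refine Finset.card_le_card ?_
        intro x hx
        simp only [Finset.mem_insert, Finset.mem_singleton] at hx
        rcases hx with rfl | rfl
        · simp [hSdef]
        · simpa [hSdef] using hab.symm) hS
      simp only [hSdef, Finset.mem_filter, Finset.mem_univ, true_and] at hx hc hd
      rw [← e.map_adj_iff, hf (by rw [hc]; exact hx), hc, ← hd, ← hf (by rw [hd]; exact hx),
        e.map_adj_iff] at hxc
      exact hxd hxc
    refine ⟨f (e a), ⟨⟨⟨fun x => ⟨e x, ?_⟩, fun x y hxy => ?_⟩, e.map_adj_iff⟩⟩⟩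
    · have : x ∈ S := hS ▸ Finset.mem_univ x
      simpa [hSdef] using this
    · exact e.injective (congrArg Subtype.val hxy)

/-! ### Induced `P₅`, co-`P₅` and `C₅` from explicit adjacencies -/

section FiveVertices

variable {V : Type*} {G : SimpleGraph V} {a b c d e : V}

theorem pathGraph_five_isIndContained (hab : G.Adj a b) (hbc : G.Adj b c) (hcd : G.Adj c d)
    (hde : G.Adj d e) (hac : ¬ G.Adj a c) (had : ¬ G.Adj a d) (hae : ¬ G.Adj a e)
    (hbd : ¬ G.Adj b d) (hbe : ¬ G.Adj b e) (hce : ¬ G.Adj c e) :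
    (pathGraph 5).IsIndContained G := by
  refine isPrimeGraph_pathGraph_five.isIndContained (by simp) ![a, b, c, d, e] fun i j => ?_
  rw [pathGraph_adj]
  fin_cases i <;> fin_cases j <;> simp [*, G.adj_comm]

theorem compl_pathGraph_five_isIndContained (hab : ¬ G.Adj a b) (hbc : ¬ G.Adj b c)
    (hcd : ¬ G.Adj c d) (hde : ¬ G.Adj d e) (hac : G.Adj a c) (had : G.Adj a d) (hae : G.Adj a e)
    (hbd : G.Adj b d) (hbe : G.Adj b e) (hce : G.Adj c e) :
    (pathGraph 5)ᶜ.IsIndContained G := by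
  refine isPrimeGraph_pathGraph_five.compl.isIndContained (by simp) ![a, b, c, d, e] fun i j => ?_
  rw [compl_adj, pathGraph_adj]
  fin_cases i <;> fin_cases j <;> simp [*, hac.symm, had.symm, hae.symm, hbd.symm, hbe.symm,
    hce.symm, mt G.adj_symm hab, mt G.adj_symm hbc, mt G.adj_symm hcd, mt G.adj_symm hde]

theorem cycleGraph_five_isIndContained (hab : G.Adj a b) (hbc : G.Adj b c) (hcd : G.Adj c d)
    (hde : G.Adj d e) (hea : G.Adj e a) (hac : ¬ G.Adj a c) (had : ¬ G.Adj a d)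
    (hbd : ¬ G.Adj b d) (hbe : ¬ G.Adj b e) (hce : ¬ G.Adj c e) :
    (cycleGraph 5).IsIndContained G := by
  refine isPrimeGraph_cycleGraph_five.isIndContained (by simp) ![a, b, c, d, e] fun i j => ?_
  have key : ∀ i j : Fin 5, (cycleGraph 5).Adj i j ↔
      (i.val + 1) % 5 = j.val ∨ (j.val + 1) % 5 = i.val := by decide
  rw [key]
  fin_cases i <;> fin_cases j <;> simp [*, hab.symm, hbc.symm, hcd.symm, hde.symm, hea.symm,
    mt G.adj_symm hac, mt G.adj_symm had, mt G.adj_symm hbd,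
    mt G.adj_symm hbe, mt G.adj_symm hce]

end FiveVertices

/-! ### Perfection of graphs without induced `P₅`, co-`P₅` and `C₅` -/

/-- Degrees are counted vertex by vertex. A vertex with more neighbors in `{a, d}` than in `{b, c}`
has one of five patterns on the path, each giving a forbidden graph. The vertex `a` itself makes the
inequality strict. -/
theorem IsP5CoP5Free.degree_add_degree_lt {V : Type*} [Fintype V] {G : SimpleGraph V}
    [DecidableRel G.Adj] (hG : G.IsP5CoP5Free) (h5 : ¬ (cycleGraph 5).IsIndContained G)
    {a b c d : V} (hab : G.Adj a b) (hbc : G.Adj b c) (hcd : G.Adj c d) (hac : ¬ G.Adj a c)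
    (had : ¬ G.Adj a d) (hbd : ¬ G.Adj b d) :
    G.degree a + G.degree d < G.degree b + G.degree c := by
  have hdeg : ∀ v, G.degree v = ∑ x, if G.Adj v x then 1 else 0 := fun v => by
    rw [← card_neighborFinset_eq_degree, neighborFinset_eq_filter, Finset.card_filter]
  have hca := mt G.adj_symm hac
  have hda := mt G.adj_symm had
  have hdb := mt G.adj_symm hbd
  simp only [hdeg, ← Finset.sum_add_distrib]
  refine Finset.sum_lt_sum (fun x _ => ?_) ⟨a, Finset.mem_univ a, by
    simp [hab.symm, hda]⟩
  by_cases h1 : G.Adj a x <;> by_cases h2 : G.Adj b x <;> by_cases h3 : G.Adj c x <;>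
    by_cases h4 : G.Adj d x <;> simp only [h1, h2, h3, h4, if_true, if_false] <;> try omega
  · exact absurd (compl_pathGraph_five_isIndContained (mt G.adj_symm h3) hca had hdb
      h1.symm h4.symm h2.symm hcd hbc.symm hab) hG.2
  · exact absurd (compl_pathGraph_five_isIndContained (mt G.adj_symm h2) hbd hda hac
      h4.symm h1.symm h3.symm hab.symm hbc hcd.symm) hG.2
  · exact absurd (cycleGraph_five_isIndContained h1.symm hab hbc hcd h4
      (mt G.adj_symm h2) (mt G.adj_symm h3) hac had hbd) h5
  · exact absurd (pathGraph_five_isIndContained h1.symm hab hbc hcd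
      (mt G.adj_symm h2) (mt G.adj_symm h3) (mt G.adj_symm h4) hac had hbd) hG.1
  · exact absurd (pathGraph_five_isIndContained h4.symm hcd.symm hbc.symm hab.symm
      (mt G.adj_symm h3) (mt G.adj_symm h2) (mt G.adj_symm h1) hdb hda hca) hG.1

/-- The ranking `r` of the vertices is a perfect order: no induced path `a b c d` has `a` before
`b` and `d` before `c`. -/
def IsPerfectRank {V : Type*} (G : SimpleGraph V) (r : V → ℕ) : Prop :=
  Function.Injective r ∧ ∀ ⦃a b c d⦄, G.Adj a b → G.Adj b c → G.Adj c d → ¬ G.Adj a c →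
    ¬ G.Adj a d → ¬ G.Adj b d → r a < r b → ¬ r d < r c

/-- If every vertex of a clique has an earlier neighbor in a given independent set, then one of
these neighbors is adjacent to the whole clique. -/
theorem IsPerfectRank.exists_adj_clique {V : Type*} {G : SimpleGraph V} {r : V → ℕ}
    (hr : G.IsPerfectRank r) {S : Set V} (hS : ∀ x ∈ S, ∀ y ∈ S, ¬ G.Adj x y) (p : V → V)
    {C : Finset V} (hC : G.IsClique C) (hne : C.Nonempty)
    (hp : ∀ w ∈ C, p w ∈ S ∧ G.Adj (p w) w ∧ r (p w) < r w) :
    ∃ w ∈ C, ∀ u ∈ C, G.Adj (p w) u := by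
  classical
  induction C using Finset.strongInduction with
  | H C ih =>
    by_contra! hcon
    -- In a minimal counterexample, for each `w` some `p t` is adjacent to all of `C` except `w`.
    -- The map `w ↦ t` is then a permutation of `C`.
    have hstep : ∀ w ∈ C, ∃ t ∈ C, t ≠ w ∧ ¬ G.Adj (p t) w ∧ ∀ u ∈ C, u ≠ w → G.Adj (p t) u := by
      intro w hw
      have hne' : (C.erase w).Nonempty := by
        obtain ⟨u, hu, hpu⟩ := hcon w hw
        refine ⟨u, Finset.mem_erase.2 ⟨?_, hu⟩⟩
        rintro rfl
        exact hpu (hp _ hw).2.1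
      obtain ⟨t, ht, hadj⟩ := ih (C.erase w) (Finset.erase_ssubset hw)
        (hC.subset (by exact_mod_cast Finset.erase_subset w C)) hne'
        (fun u hu => hp u (Finset.mem_of_mem_erase hu))
      have hadj' : ∀ u ∈ C, u ≠ w → G.Adj (p t) u := fun u hu huw =>
        hadj u (Finset.mem_erase.2 ⟨huw, hu⟩)
      refine ⟨t, Finset.mem_of_mem_erase ht, Finset.ne_of_mem_erase ht, fun h => ?_, hadj'⟩
      obtain ⟨u, hu, hpu⟩ := hcon t (Finset.mem_of_mem_erase ht)
      by_cases huw : u = w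
      · exact hpu (huw ▸ h)
      · exact hpu (hadj' u hu huw)
    choose! t htC htne hnadj hadj using hstep
    have hinj : Set.InjOn t C := by
      intro w hw w' hw' h
      by_contra hne
      exact hnadj w' hw' (h ▸ hadj w hw w' hw' (Ne.symm hne))
    have hsurj : ∀ w ∈ C, ∃ m ∈ C, t m = w := by
      have := Finset.surjOn_of_injOn_of_card_le t (fun w hw => htC w hw) hinj le_rfl
      intro w hw
      simpa using this hw
    -- With `p (t m)` earliest and `m = t m'`, the induced path `p (t m)`, `m'`, `m`, `p m` violates
    -- the perfect order.
    obtain ⟨w, hw, hmin⟩ := C.exists_min_image (fun w => r (p w)) hne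
    obtain ⟨m, hm, rfl⟩ := hsurj w hw
    obtain ⟨m', hm', hmm'⟩ := hsurj m hm
    have hne' : m' ≠ m := by
      rintro rfl
      exact htne _ hm hmm'
    have hx : G.Adj (p (t m)) m' := hadj m hm m' hm' hne'
    have hy := hnadj m' hm'
    rw [hmm'] at hy
    exact hr.2 hx (hC hm' hm hne') (hp m hm).2.1.symm (hnadj m hm)
      (hS _ (hp _ hw).1 _ (hp m hm).1) (mt G.adj_symm hy)
      ((hmin m' hm').trans_lt (hp m' hm').2.2) (hp m hm).2.2

/-- Each vertex receives the least color not used on its earlier neighbors. -/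
theorem exists_greedy_coloring {V : Type*} [Finite V] (G : SimpleGraph V) {r : V → ℕ}
    (hr : Function.Injective r) : ∃ c : V → ℕ, (∀ u v, G.Adj u v → c u ≠ c v) ∧
      ∀ v, ∀ j < c v, ∃ u, G.Adj u v ∧ r u < r v ∧ c u = j := by
  classical
  have := Fintype.ofFinite V
  have wf : WellFounded fun a b : V => r a < r b := (measure r).wf
  let F : ∀ v : V, (∀ u, r u < r v → ℕ) → ℕ := fun v g =>
    sInf {j | ∀ u (h : r u < r v), G.Adj u v → g u h ≠ j}
  let c : V → ℕ := wf.fix F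
  have hc : ∀ v, c v = sInf {j | ∀ u, r u < r v → G.Adj u v → c u ≠ j} := fun v => wf.fix_eq F v
  have hmem : ∀ v u, r u < r v → G.Adj u v → c u ≠ c v := by
    intro v
    have hne : {j | ∀ u, r u < r v → G.Adj u v → c u ≠ j}.Nonempty := by
      obtain ⟨j, hj⟩ := Infinite.exists_notMem_finset (Finset.univ.image c)
      exact ⟨j, fun u _ _ e => hj (Finset.mem_image.2 ⟨u, Finset.mem_univ u, e⟩)⟩
    have := Nat.sInf_mem hne
    rw [← hc v] at this
    exact this
  refine ⟨c, fun u v huv => ?_, fun v j hj => ?_⟩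
  · rcases lt_trichotomy (r u) (r v) with h | h | h
    · exact hmem v u h huv
    · exact absurd (hr h) huv.ne
    · exact (hmem u v h huv.symm).symm
  · rw [hc v] at hj
    have := Nat.notMem_of_lt_sInf hj
    simp only [Set.mem_ofPred_eq, not_forall, not_not] at this
    obtain ⟨u, h1, h2, h3⟩ := this
    exact ⟨u, h2, h1, h3⟩

/-- A vertex of greedy color `c v` starts a clique that grows downward through the colors `c v - 1,
…, 0`. Each clique vertex has an earlier neighbor of the next color, and one such neighbor sees the
whole clique. -/
theorem IsPerfectRank.colorable {V : Type*} [Finite V] {G : SimpleGraph V} {r : V → ℕ}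
    (hr : G.IsPerfectRank r) {n : ℕ} (hn : G.CliqueFree (n + 1)) : G.Colorable n := by
  classical
  obtain ⟨c, hc, hgreedy⟩ := G.exists_greedy_coloring hr.1
  rw [colorable_iff_exists_bdd_nat_coloring]
  refine ⟨Coloring.mk c fun {u v} h => hc u v h, fun v => ?_⟩
  change c v < n
  by_contra! hv
  have key : ∀ i ≤ c v, ∃ C : Finset V, G.IsClique C ∧ C.card = i + 1 ∧ ∀ w ∈ C, c v - i ≤ c w := by
    intro i
    induction i with
    | zero => exact fun _ => ⟨{v}, by simp, by simp, by simp⟩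
    | succ i ih =>
      intro hi
      obtain ⟨C, hC, hcard, hcol⟩ := ih (by omega)
      have hex : ∀ w ∈ C, ∃ u, G.Adj u w ∧ r u < r w ∧ c u = c v - (i + 1) := fun w hw =>
        hgreedy w _ (by have := hcol w hw; omega)
      choose! p hp1 hp2 hp3 using hex
      obtain ⟨w, hw, hadj⟩ := hr.exists_adj_clique (S := {x | c x = c v - (i + 1)})
        (fun x hx y hy h => hc x y h (hx.trans hy.symm)) p hC
        (Finset.card_pos.1 (by omega)) (fun w hw => ⟨hp3 w hw, hp1 w hw, hp2 w hw⟩)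
      refine ⟨insert (p w) C, ?_, ?_, ?_⟩
      · rw [Finset.coe_insert]
        exact hC.insert fun u hu _ => hadj u hu
      · rw [Finset.card_insert_of_notMem fun h => G.irrefl (hadj _ h), hcard]
      · intro u hu
        rcases Finset.mem_insert.1 hu with rfl | hu
        · exact (hp3 w hw).ge
        · have := hcol u hu
          omega
  obtain ⟨C, hC, hcard, -⟩ := key (c v) le_rfl
  exact hn.mono (by omega : n + 1 ≤ c v + 1) C ⟨hC, hcard⟩

theorem IsP5CoP5Free.colorable_of_cliqueFree {V : Type*} [Finite V] {G : SimpleGraph V}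
    (hG : G.IsP5CoP5Free) (h5 : ¬ (cycleGraph 5).IsIndContained G) {n : ℕ}
    (hn : G.CliqueFree (n + 1)) : G.Colorable n := by
  classical
  have := Fintype.ofFinite V
  let N := Fintype.card V
  -- Larger degree comes first; the second summand is below `N` and only breaks ties.
  let r : V → ℕ := fun v => (N - G.degree v) * N + Fintype.equivFin V v
  have hlt : ∀ v, (Fintype.equivFin V v : ℕ) < N := fun v => (Fintype.equivFin V v).2
  have hdeg : ∀ u v, r u ≤ r v → G.degree v ≤ G.degree u := by
    intro u v h
    by_contra! hd
    have h1 : N - G.degree v + 1 ≤ N - G.degree u := by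
      have : G.degree v < N := G.degree_lt_card_verts v
      omega
    have h2 := Nat.mul_le_mul_right N h1
    have h3 := hlt v
    simp only [r] at h
    rw [add_mul, one_mul] at h2
    omega
  refine IsPerfectRank.colorable (r := r) ⟨fun u v h => ?_, ?_⟩ hn
  · have hd : G.degree u = G.degree v := le_antisymm (hdeg v u h.ge) (hdeg u v h.le)
    simp only [r, hd, Nat.add_left_cancel_iff] at h
    exact (Fintype.equivFin V).injective (Fin.ext h)
  · intro a b c d hab hbc hcd hac had hbd h1 h2
    have := hG.degree_add_degree_lt h5 hab hbc hcd hac had hbd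
    have := hdeg _ _ h1.le
    have := hdeg _ _ h2.le
    omega

/-! ### Substitution and weighted perfection -/

theorem isModularMap_substitute {I : Type v} (Q : SimpleGraph I) {W : I → Type u}
    (B : ∀ i, SimpleGraph (W i)) : (Q.substitute B).IsModularMap Q Sigma.fst := by
  rintro ⟨i, x⟩ ⟨j, y⟩ h
  refine or_iff_left ?_
  rintro ⟨l, a, b, ha, hb, -⟩
  exact h ((congrArg Sigma.fst ha).trans (congrArg Sigma.fst hb).symm)

theorem substitute_adj_mk {I : Type v} {Q : SimpleGraph I} {W : I → Type u}
    {B : ∀ i, SimpleGraph (W i)} {i : I} {a b : W i} :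
    (Q.substitute B).Adj ⟨i, a⟩ ⟨i, b⟩ ↔ (B i).Adj a b := by
  constructor
  · rintro (h | ⟨j, x, y, hx, hy, h⟩)
    · exact absurd h (Q.irrefl)
    · obtain rfl : i = j := congrArg Sigma.fst hx
      obtain rfl : a = x := by simpa using hx
      obtain rfl : b = y := by simpa using hy
      exact h
  · exact fun h => Or.inr ⟨i, a, b, rfl, rfl, h⟩

/-- Weighted perfection: the number of colors needed is the largest weight of a clique. -/
theorem IsP5CoP5Free.exists_isClique_lt_sum {I : Type*} [Finite I] {Q : SimpleGraph I}
    (hQ : Q.IsP5CoP5Free) (h5 : ¬ (cycleGraph 5).IsIndContained Q) {κ : I → ℕ} {n : ℕ}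
    (hn : ¬ Q.WeightColorable κ n) : ∃ T : Finset I, Q.IsClique T ∧ n < ∑ i ∈ T, κ i := by
  classical
  -- Each vertex `i` is replaced by a clique of size `κ i`, possibly empty; colorings and cliques of
  -- `H` are weighted ones of `Q`.
  let H := Q.substitute fun i => (⊤ : SimpleGraph (Fin (κ i)))
  have hH : H.IsModularMap Q Sigma.fst := isModularMap_substitute _ _
  have hfree : ∀ P : SimpleGraph (Fin 5), P.IsPrimeGraph → (∃ a b, a ≠ b ∧ ¬ P.Adj a b) →
      ¬ P.IsIndContained Q → ¬ P.IsIndContained H := by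
    rintro P hP ⟨a, b, hab, hPab⟩ hPQ hPH
    refine (hH.isIndContained_or hP hPH).elim hPQ ?_
    rintro ⟨i, ⟨e⟩⟩
    refine hPab (e.map_adj_iff.1 ?_)
    have hcomplete : ∀ x y : Σ i, Fin (κ i), x.1 = y.1 → x ≠ y → H.Adj x y := by
      rintro ⟨i, x⟩ ⟨j, y⟩ h hxy
      obtain rfl : i = j := h
      exact substitute_adj_mk.2 ((top_adj _ _).2 fun e => hxy (e ▸ rfl))
    exact hcomplete _ _ ((e a).2.trans (e b).2.symm) fun h => e.injective.ne hab (Subtype.ext h)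
  have hcol : ¬ H.Colorable n := by
    refine fun h => hn (hH.weightColorable (fun i m hm => ?_) h)
    have := hm.card_le_of_pairwise_adj (fun a : Fin (κ i) => (⟨⟨i, a⟩, rfl⟩ : Sigma.fst ⁻¹' {i}))
      (fun a b hab => substitute_adj_mk.2 ((top_adj _ _).2 hab))
    simpa using this
  have hclique : ¬ H.CliqueFree (n + 1) := by
    refine mt (IsP5CoP5Free.colorable_of_cliqueFree ⟨?_, ?_⟩ ?_) hcol
    · exact hfree _ isPrimeGraph_pathGraph_five ⟨0, 2, by decide, by simp [pathGraph_adj]⟩ hQ.1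
    · exact hfree _ isPrimeGraph_pathGraph_five.compl ⟨0, 1, by decide, by
        simp [compl_adj, pathGraph_adj]⟩ hQ.2
    · exact hfree _ isPrimeGraph_cycleGraph_five ⟨0, 2, by decide, by decide⟩ h5
  simp only [CliqueFree, not_forall, not_not] at hclique
  obtain ⟨K, hK, hKcard⟩ := hclique
  refine ⟨K.image Sigma.fst, ?_, ?_⟩
  · intro i hi j hj hij
    simp only [Finset.coe_image, Set.mem_image, Finset.mem_coe] at hi hj
    obtain ⟨x, hx, rfl⟩ := hi
    obtain ⟨y, hy, rfl⟩ := hj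
    exact (hH hij).1 (hK hx hy fun e => hij (congrArg _ e))
  · have hsub : K ⊆ (K.image Sigma.fst).sigma fun i => (Finset.univ : Finset (Fin (κ i))) :=
      fun x hx => Finset.mem_sigma.2 ⟨Finset.mem_image_of_mem _ hx, Finset.mem_univ _⟩
    have := Finset.card_le_card hsub
    rw [Finset.card_sigma, hKcard] at this
    simpa using this

/-! ### Prime quotients -/

theorem IsModularMap.exists_fin {V J : Type*} [Fintype J] {G : SimpleGraph V} {R : SimpleGraph J}
    {g : V → J} (hg : G.IsModularMap R g) (hs : Function.Surjective g) :
    ∃ (Q : SimpleGraph (Fin (Fintype.card J))) (f : V → Fin (Fintype.card J)),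
      Function.Surjective f ∧ G.IsModularMap Q f := by
  let e := Fintype.equivFin J
  refine ⟨R.comap e.symm, e ∘ g, e.surjective.comp hs, fun u v h => ?_⟩
  simpa using hg fun he => h (congrArg e he)

/-- In a modular partition with the fewest parts, at least two, a nontrivial module of the quotient
could be contracted to one of its vertices `s`, leaving fewer parts. -/
theorem exists_prime_quotient {V : Type*} [Finite V] [Nontrivial V] (G : SimpleGraph V) :
    ∃ (n : ℕ) (Q : SimpleGraph (Fin n)) (f : V → Fin n), 2 ≤ n ∧ Function.Surjective f ∧
      G.IsModularMap Q f ∧ Q.IsPrimeGraph := by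
  classical
  have := Fintype.ofFinite V
  have hex : ∃ n, 2 ≤ n ∧ ∃ (Q : SimpleGraph (Fin n)) (f : V → Fin n),
      Function.Surjective f ∧ G.IsModularMap Q f :=
    ⟨_, Fintype.one_lt_card, IsModularMap.exists_fin (R := G) (g := id) (fun _ _ _ => Iff.rfl)
      Function.surjective_id⟩
  obtain ⟨h2, Q, f, hs, hmod⟩ := Nat.find_spec hex
  refine ⟨_, Q, f, h2, hs, hmod, ?_⟩
  intro S hS2 hSu
  by_contra! hcon
  obtain ⟨s, hsS, t, htS, hst⟩ := Finset.one_lt_card.1 hS2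
  obtain ⟨z, hz⟩ : ∃ z, z ∉ S := by
    by_contra! h
    exact hSu (Finset.eq_univ_iff_forall.2 h)
  let J := {x // x ∉ S ∨ x = s}
  let g : Fin (Nat.find hex) → J := fun x =>
    if hx : x ∈ S then ⟨s, Or.inr rfl⟩ else ⟨x, Or.inl hx⟩
  have hgS : ∀ x, x ∈ S → (g x).1 = s := fun x hx => by simp [g, hx]
  have hgn : ∀ x, x ∉ S → (g x).1 = x := fun x hx => by simp [g, hx]
  have hgs : Function.Surjective g := by
    rintro ⟨x, hx⟩
    refine ⟨x, Subtype.ext ?_⟩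
    rcases hx with hx | rfl
    · exact hgn x hx
    · exact hgS x hsS
  have hmodule : ∀ x, x ∉ S → ∀ y ∈ S, (Q.Adj x y ↔ Q.Adj x s) := fun x hx y hy =>
    ⟨hcon x hx y hy s hsS, hcon x hx s hsS y hy⟩
  have hgm : Q.IsModularMap (Q.comap (Subtype.val : J → _)) g := by
    intro x y hxy
    rw [comap_adj]
    by_cases hx : x ∈ S
    · by_cases hy : y ∈ S
      · exact absurd (Subtype.ext ((hgS x hx).trans (hgS y hy).symm)) hxy
      · rw [hgS x hx, hgn y hy, Q.adj_comm x, Q.adj_comm s]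
        exact hmodule y hy x hx
    · by_cases hy : y ∈ S
      · rw [hgn x hx, hgS y hy]
        exact hmodule x hx y hy
      · rw [hgn x hx, hgn y hy]
  have hJ2 : 2 ≤ Fintype.card J := Fintype.one_lt_card_iff.2
    ⟨⟨s, Or.inr rfl⟩, ⟨z, Or.inl hz⟩, fun e => hz (by rwa [← show s = z from congrArg Subtype.val e])⟩
  have hlt : Fintype.card J < Nat.find hex := by
    have := Fintype.card_subtype_lt (p := fun x => x ∉ S ∨ x = s) (x := t) (by
      rintro (h | h)
      · exact h htS
      · exact hst h.symm)
    simpa using this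
  exact Nat.find_min hex hlt ⟨hJ2, (hgm.comp hmod).exists_fin (hgs.comp hs)⟩

theorem IsModularMap.isIndContained_of_surjective {V I : Type*} {G : SimpleGraph V}
    {Q : SimpleGraph I} {f : V → I} (hf : G.IsModularMap Q f) (hs : Function.Surjective f) :
    Q.IsIndContained G := by
  refine ⟨⟨⟨Function.surjInv hs, Function.injective_surjInv hs⟩, fun {i j} => ?_⟩⟩
  by_cases hij : i = j
  · subst hij; simp
  · have := hf (u := Function.surjInv hs i) (v := Function.surjInv hs j) (by
      rwa [Function.surjInv_eq hs, Function.surjInv_eq hs])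
    rwa [Function.surjInv_eq hs, Function.surjInv_eq hs] at this

theorem IsP5CoP5Free.of_isIndContained {V W : Type*} {G : SimpleGraph V} {H : SimpleGraph W}
    (hG : G.IsP5CoP5Free) (h : H.IsIndContained G) : H.IsP5CoP5Free :=
  ⟨fun h' => hG.1 (h'.trans h), fun h' => hG.2 (h'.trans h)⟩

/-! ### Induced cycles of length five -/

/-- The neighborhood of a further vertex on an induced `C₅` is full, empty, or agrees, up to one
vertex `i`, with the neighborhood of `i`. -/
def IsBuoyPattern (p : Fin 5 → Bool) : Prop :=
  (∀ i, p i = true) ∨ (∀ i, p i = false) ∨ ∃ i, ∀ j, j ≠ i → p j = decide ((cycleGraph 5).Adj i j)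

instance (p : Fin 5 → Bool) : Decidable (IsBuoyPattern p) := by
  unfold IsBuoyPattern
  infer_instance

/-- Every other pattern gives an induced `P₅` or co-`P₅` on the new vertex and four cycle vertices;
the adjacency to the fifth is irrelevant. -/
theorem isBuoyPattern_or (p : Fin 5 → Bool) : IsBuoyPattern p ∨
    (∃ i, p i = true ∧ p (i + 1) = false ∧ p (i + 2) = false ∧ p (i + 3) = false) ∨
    (∃ i, p i = false ∧ p (i + 2) = true ∧ p (i + 4) = true ∧ p (i + 1) = true) := by
  revert p
  decide

/-- This permits exchanging the cycle vertex at `j` for another vertex of the same bag: the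
remaining three values determine the new one. -/
theorem IsBuoyPattern.eq_of_forall {q : Fin 5 → Bool} (hq : IsBuoyPattern q) {i j : Fin 5}
    (hij : j ≠ i) (h : ∀ l, l ≠ j → l ≠ i → q l = decide ((cycleGraph 5).Adj i l)) :
    q j = decide ((cycleGraph 5).Adj i j) := by
  revert q i j
  decide

theorem IsP5CoP5Free.isBuoyPattern {V : Type*} {G : SimpleGraph V} (hG : G.IsP5CoP5Free)
    {c : Fin 5 → V} (hc : ∀ i j, G.Adj (c i) (c j) ↔ (cycleGraph 5).Adj i j) (x : V)
    {p : Fin 5 → Bool} (hp : ∀ i, p i = true ↔ G.Adj x (c i)) : IsBuoyPattern p := by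
  have hp' : ∀ i, p i = false ↔ ¬ G.Adj x (c i) := fun i => by rw [← hp i]; simp
  rcases isBuoyPattern_or p with h | ⟨i, h0, h1, h2, h3⟩ | ⟨i, h0, h1, h2, h3⟩
  · exact h
  · refine absurd (pathGraph_five_isIndContained ((hp _).1 h0) ((hc i (i + 1)).2 ?_)
      ((hc (i + 1) (i + 2)).2 ?_) ((hc (i + 2) (i + 3)).2 ?_) ((hp' _).1 h1) ((hp' _).1 h2)
      ((hp' _).1 h3) ((hc i (i + 2)).not.2 ?_) ((hc i (i + 3)).not.2 ?_)
      ((hc (i + 1) (i + 3)).not.2 ?_)) hG.1 <;>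
    · clear h0 h1 h2 h3
      revert i
      decide
  · refine absurd (compl_pathGraph_five_isIndContained ((hp' _).1 h0) ((hc i (i + 2)).not.2 ?_)
      ((hc (i + 2) (i + 4)).not.2 ?_) ((hc (i + 4) (i + 1)).not.2 ?_) ((hp _).1 h1) ((hp _).1 h2)
      ((hp _).1 h3) ((hc i (i + 4)).2 ?_) ((hc i (i + 1)).2 ?_)
      ((hc (i + 2) (i + 1)).2 ?_)) hG.2 <;>
    · clear h0 h1 h2 h3
      revert i
      decide

/-- The set `S` induces a buoy, whose bags are the fibers of `g`. -/
def IsBuoyOn {V : Type*} (G : SimpleGraph V) (S : Finset V) (g : V → Fin 5) : Prop :=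
  (∀ i, ∃ v ∈ S, g v = i) ∧
    ∀ u ∈ S, ∀ v ∈ S, g u ≠ g v → (G.Adj u v ↔ (cycleGraph 5).Adj (g u) (g v))

/-- A vertex with both a neighbor and a non-neighbor in a buoy can be added to one of its bags. -/
theorem IsBuoyOn.exists_insert {V : Type*} [DecidableEq V] {G : SimpleGraph V}
    (hG : G.IsP5CoP5Free) {S : Finset V} {g : V → Fin 5} (hS : G.IsBuoyOn S g) {x a b : V}
    (hx : x ∉ S) (ha : a ∈ S) (hb : b ∈ S) (hxa : G.Adj x a) (hxb : ¬ G.Adj x b) :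
    ∃ i, G.IsBuoyOn (insert x S) (Function.update g x i) := by
  classical
  obtain ⟨hsurj, hadj⟩ := hS
  have hpat : ∀ c : Fin 5 → V, (∀ i, c i ∈ S ∧ g (c i) = i) →
      IsBuoyPattern fun i => decide (G.Adj x (c i)) := by
    refine fun c hc => hG.isBuoyPattern (c := c) (fun i j => ?_) x (fun i => by simp)
    by_cases hij : i = j
    · subst hij; simp
    · have := hadj (c i) (hc i).1 (c j) (hc j).1 (by rwa [(hc i).2, (hc j).2])
      rwa [(hc i).2, (hc j).2] at this
  have hupd : ∀ c : Fin 5 → V, (∀ i, c i ∈ S ∧ g (c i) = i) → ∀ y ∈ S,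
      ∀ i, Function.update c (g y) y i ∈ S ∧ g (Function.update c (g y) y i) = i := by
    intro c hc y hy i
    by_cases hi : i = g y
    · subst hi; simpa using hy
    · rw [Function.update_of_ne hi]
      exact hc i
  -- Any transversal cycle is rerouted through `a`. If `x` sees all of it, rerouting through `b`
  -- adds a non-neighbor and keeps a neighbor.
  obtain ⟨c, hc, ⟨i₁, h₁⟩, ⟨i₂, h₂⟩⟩ : ∃ c : Fin 5 → V, (∀ i, c i ∈ S ∧ g (c i) = i) ∧
      (∃ i, G.Adj x (c i)) ∧ ∃ i, ¬ G.Adj x (c i) := by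
    choose c hcS hcg using hsurj
    have hc := hupd c (fun i => ⟨hcS i, hcg i⟩) a ha
    by_cases hall : ∀ i, G.Adj x (Function.update c (g a) a i)
    · refine ⟨_, hupd _ hc b hb, ⟨g b + 1, ?_⟩, ⟨g b, by simpa using hxb⟩⟩
      rw [Function.update_of_ne (by generalize g b = i; revert i; decide)]
      exact hall _
    · exact ⟨_, hc, ⟨g a, by simpa using hxa⟩, not_forall.1 hall⟩
  obtain ⟨i, hi⟩ : ∃ i, ∀ j, j ≠ i → (G.Adj x (c j) ↔ (cycleGraph 5).Adj i j) := by
    rcases hpat c hc with h | h | ⟨i, h⟩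
    · exact absurd (by simpa using h i₂) h₂
    · exact absurd h₁ (by simpa using h i₁)
    · exact ⟨i, fun j hj => by simpa using h j hj⟩
  have hkey : ∀ y ∈ S, g y ≠ i → (G.Adj x y ↔ (cycleGraph 5).Adj i (g y)) := by
    intro y hy hyi
    have := (hpat _ (hupd c hc y hy)).eq_of_forall hyi (fun l hl hli => by
      rw [Function.update_of_ne hl]
      simpa using hi l hli)
    simpa using this
  have hg : ∀ y ∈ S, Function.update g x i y = g y := fun y hy =>
    Function.update_of_ne (ne_of_mem_of_not_mem hy hx) _ _
  refine ⟨i, fun j => ?_, fun u hu v hv huv => ?_⟩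
  · obtain ⟨y, hy, hyj⟩ := hsurj j
    exact ⟨y, Finset.mem_insert_of_mem hy, (hg y hy).trans hyj⟩
  · rcases Finset.mem_insert.1 hu with rfl | hu'
    · rcases Finset.mem_insert.1 hv with rfl | hv'
      · exact absurd rfl huv
      · rw [Function.update_self, hg v hv'] at huv ⊢
        exact hkey v hv' huv.symm
    · rcases Finset.mem_insert.1 hv with rfl | hv'
      · rw [Function.update_self, hg u hu'] at huv ⊢
        rw [G.adj_comm, (cycleGraph 5).adj_comm]
        exact hkey u hu' huv
      · rw [hg u hu', hg v hv'] at huv ⊢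
        exact hadj u hu' v hv' huv

/-- A largest set inducing a buoy, if proper, is not a module, so some outside vertex is mixed on it
and can be inserted. -/
theorem IsPrimeGraph.exists_modularMap_cycleGraph {V : Type*} [Fintype V] {G : SimpleGraph V}
    (hprime : G.IsPrimeGraph) (hG : G.IsP5CoP5Free) (h5 : (cycleGraph 5).IsIndContained G) :
    ∃ g : V → Fin 5, Function.Surjective g ∧ G.IsModularMap (cycleGraph 5) g := by
  classical
  obtain ⟨e⟩ := h5
  let 𝒮 : Finset (Finset V) := Finset.univ.filter fun S => ∃ g, G.IsBuoyOn S g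
  have hne : 𝒮.Nonempty := by
    have hinv : ∀ i, Function.invFun e (e i) = i := Function.leftInverse_invFun e.injective
    refine ⟨Finset.univ.image e, Finset.mem_filter.2 ⟨Finset.mem_univ _, Function.invFun e,
      fun i => ⟨e i, Finset.mem_image_of_mem _ (Finset.mem_univ i), hinv i⟩, ?_⟩⟩
    intro u hu v hv _
    obtain ⟨i, -, rfl⟩ := Finset.mem_image.1 hu
    obtain ⟨j, -, rfl⟩ := Finset.mem_image.1 hv
    rw [hinv, hinv]
    exact e.map_adj_iff
  obtain ⟨S, hS, hmax⟩ := 𝒮.exists_max_image Finset.card hne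
  obtain ⟨g, hg⟩ := (Finset.mem_filter.1 hS).2
  have huniv : S = Finset.univ := by
    by_contra hSu
    have hcard : 2 ≤ S.card := by
      obtain ⟨u, hu, hu0⟩ := hg.1 0
      obtain ⟨v, hv, hv1⟩ := hg.1 1
      exact Finset.one_lt_card.2 ⟨u, hu, v, hv, fun e => by simp [e, hv1] at hu0⟩
    obtain ⟨x, hx, a, ha, b, hb, hxa, hxb⟩ := hprime S hcard hSu
    obtain ⟨i, hi⟩ := hg.exists_insert hG hx ha hb hxa hxb
    have := hmax (insert x S) (Finset.mem_filter.2 ⟨Finset.mem_univ _, _, hi⟩)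
    rw [Finset.card_insert_of_notMem hx] at this
    omega
  subst huniv
  refine ⟨g, fun i => ?_, fun u v h => hg.2 u (Finset.mem_univ u) v (Finset.mem_univ v) h⟩
  obtain ⟨v, -, hv⟩ := hg.1 i
  exact ⟨v, hv⟩

/-! ### Isomorphisms -/

theorem IsCritical.of_iso {V W : Type*} {G : SimpleGraph V} {H : SimpleGraph W} {k : ℕ}
    (hk : 0 < k) (hG : G.IsCritical k) (e : G ≃g H) : H.IsCritical k := by
  rw [isCritical_iff_colorable hk] at hG ⊢
  refine ⟨(colorable_congr e).1 hG.1, fun n hn => hG.2.1 n ((colorable_congr e).2 hn), fun w =>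
    (hG.2.2 (e.symm w)).of_hom ⟨fun x => ⟨e.symm x.1, fun h => x.2 (e.symm.injective h)⟩, ?_⟩⟩
  intro a b h
  exact e.symm.map_adj_iff.2 (show H.Adj a b from h)

theorem MemC.of_iso {V W : Type*} {G : SimpleGraph V} {H : SimpleGraph W} {k : ℕ}
    (hk : 0 < k) (hG : G.MemC k) (e : G ≃g H) : H.MemC k :=
  ⟨hG.1.of_iso hk e, hG.2.of_isIndContained ⟨e.symm.toEmbedding⟩⟩

theorem IsModularMap.nonempty_iso_substitute {V I : Type*} {G : SimpleGraph V}
    {Q : SimpleGraph I} {f : V → I} (hf : G.IsModularMap Q f) :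
    Nonempty (G ≃g Q.substitute (G.fiber f)) := by
  refine ⟨⟨⟨fun v => ⟨f v, v, rfl⟩, fun x => x.2.1, fun v => rfl, ?_⟩, ?_⟩⟩
  · rintro ⟨_, v, rfl⟩
    rfl
  · intro u v
    change (Q.substitute (G.fiber f)).Adj ⟨f u, u, rfl⟩ ⟨f v, v, rfl⟩ ↔ _
    by_cases h : f u = f v
    · have : (⟨f v, v, rfl⟩ : Σ i, f ⁻¹' {i}) = ⟨f u, v, h.symm⟩ := by
        have key : ∀ i (hi : f v = i), (⟨f v, v, rfl⟩ : Σ i, f ⁻¹' {i}) = ⟨i, v, hi⟩ := by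
          rintro _ rfl
          rfl
        exact key _ _
      rw [this]
      exact substitute_adj_mk
    · exact (isModularMap_substitute Q (G.fiber f) h).trans (hf h).symm

theorem nonempty_iso_fiber_substitute {I : Type v} (Q : SimpleGraph I) {W : I → Type u}
    (B : ∀ i, SimpleGraph (W i)) (i : I) :
    Nonempty (B i ≃g (Q.substitute B).fiber Sigma.fst i) := by
  refine ⟨⟨Equiv.ofBijective (fun a => ⟨⟨i, a⟩, rfl⟩) ⟨fun a b h => ?_, ?_⟩, substitute_adj_mk⟩⟩
  · simpa using congrArg Subtype.val h
  · rintro ⟨⟨_, a⟩, rfl⟩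
    exact ⟨a, rfl⟩

theorem isModularMap_joinGraph {V : Type u} {W : Type v} (G : SimpleGraph V) (H : SimpleGraph W) :
    (G.joinGraph H).IsModularMap ⊤ Sum.isLeft := by
  rintro (a | a) (b | b) h <;> simp_all [joinGraph]

theorem IsModularMap.nonempty_iso_joinGraph {V : Type*} {G : SimpleGraph V} {f : V → Bool}
    (hf : G.IsModularMap ⊤ f) :
    Nonempty (G ≃g (G.fiber f true).joinGraph (G.fiber f false)) := by
  refine ⟨Iso.symm ⟨Equiv.ofBijective (Sum.elim Subtype.val Subtype.val) ⟨?_, fun v => ?_⟩, ?_⟩⟩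
  · rintro (⟨a, ha⟩ | ⟨a, ha⟩) (⟨b, hb⟩ | ⟨b, hb⟩) h <;> obtain rfl : a = b := h
    · rfl
    · exact absurd (Eq.trans (Eq.symm ha) hb) (by decide)
    · exact absurd (Eq.trans (Eq.symm ha) hb) (by decide)
    · rfl
  · cases h : f v
    · exact ⟨Sum.inr ⟨v, h⟩, rfl⟩
    · exact ⟨Sum.inl ⟨v, h⟩, rfl⟩
  · have hadj : ∀ {a b}, f a = true → f b = false → G.Adj a b := fun ha hb =>
      (hf (by simp [ha, hb])).2 (by simp [ha, hb])
    rintro (⟨a, ha⟩ | ⟨a, ha⟩) (⟨b, hb⟩ | ⟨b, hb⟩)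
    · rfl
    · exact iff_of_true (hadj ha hb) trivial
    · exact iff_of_true (hadj hb ha).symm trivial
    · rfl

theorem nonempty_iso_fiber_joinGraph_true {V : Type u} {W : Type v} (G : SimpleGraph V)
    (H : SimpleGraph W) : Nonempty (G ≃g (G.joinGraph H).fiber Sum.isLeft true) := by
  refine ⟨⟨Equiv.ofBijective (fun a => ⟨Sum.inl a, rfl⟩) ⟨fun a b h => ?_, ?_⟩, Iff.rfl⟩⟩
  · simpa using congrArg Subtype.val h
  · rintro ⟨a | a, ha⟩
    · exact ⟨a, rfl⟩
    · simp at ha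

theorem nonempty_iso_fiber_joinGraph_false {V : Type u} {W : Type v} (G : SimpleGraph V)
    (H : SimpleGraph W) : Nonempty (H ≃g (G.joinGraph H).fiber Sum.isLeft false) := by
  refine ⟨⟨Equiv.ofBijective (fun a => ⟨Sum.inr a, rfl⟩) ⟨fun a b h => ?_, ?_⟩, Iff.rfl⟩⟩
  · simpa using congrArg Subtype.val h
  · rintro ⟨a | a, ha⟩
    · simp at ha
    · exact ⟨a, rfl⟩

/-! ### The characterization -/

theorem IsModularMap.isP5CoP5Free {V I : Type*} {G : SimpleGraph V} {Q : SimpleGraph I}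
    {f : V → I} (hf : G.IsModularMap Q f) (hQ : Q.IsP5CoP5Free)
    (hB : ∀ i, (G.fiber f i).IsP5CoP5Free) : G.IsP5CoP5Free :=
  ⟨fun h => (hf.isIndContained_or isPrimeGraph_pathGraph_five h).elim hQ.1
      fun ⟨i, hi⟩ => (hB i).1 hi,
    fun h => (hf.isIndContained_or isPrimeGraph_pathGraph_five.compl h).elim hQ.2
      fun ⟨i, hi⟩ => (hB i).2 hi⟩

theorem isP5CoP5Free_top_bool : (⊤ : SimpleGraph Bool).IsP5CoP5Free := by
  constructor <;>
  · rintro ⟨e⟩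
    simpa using Fintype.card_le_of_injective e e.injective

theorem isP5CoP5Free_cycleGraph_five : (cycleGraph 5).IsP5CoP5Free := by
  constructor
  · rintro ⟨e⟩
    -- An end of `P₅` has three non-neighbors, and in the complement three neighbors; a vertex of
    -- `C₅` has two of each.
    have key : ∀ a x y z : Fin 5, a ≠ x → a ≠ y → a ≠ z → x ≠ y → x ≠ z → y ≠ z →
        (cycleGraph 5).Adj a x ∨ (cycleGraph 5).Adj a y ∨ (cycleGraph 5).Adj a z := by decide
    have := key (e 0) (e 2) (e 3) (e 4) (e.injective.ne (by decide)) (e.injective.ne (by decide))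
      (e.injective.ne (by decide)) (e.injective.ne (by decide)) (e.injective.ne (by decide))
      (e.injective.ne (by decide))
    simp only [e.map_adj_iff] at this
    simp [pathGraph_adj] at this
  · rintro ⟨e⟩
    have key : ∀ a x y z : Fin 5, x ≠ y → x ≠ z → y ≠ z →
        ¬ ((cycleGraph 5).Adj a x ∧ (cycleGraph 5).Adj a y ∧ (cycleGraph 5).Adj a z) := by decide
    have := key (e 0) (e 2) (e 3) (e 4) (e.injective.ne (by decide)) (e.injective.ne (by decide))
      (e.injective.ne (by decide))
    simp only [e.map_adj_iff] at this
    simp [compl_adj, pathGraph_adj] at this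

theorem IsCritical.nonempty {V : Type*} {G : SimpleGraph V} {k : ℕ} (hk : 0 < k)
    (hG : G.IsCritical k) : Nonempty V := by
  by_contra h
  have := not_nonempty_iff.1 h
  have := ((isCritical_iff_colorable hk).1 hG).2.1 0 (Colorable.of_isEmpty 0)
  omega

theorem IsConstruction1.memC {V : Type u} [Finite V] {G : SimpleGraph V} {k : ℕ}
    (h : G.IsConstruction1 k) : G.MemC k := by
  obtain ⟨k₁, k₂, V₁, V₂, G₁, G₂, h₁, h₂, rfl, hG₁, hG₂, ⟨e⟩⟩ := h
  have hfin : Finite (V₁ ⊕ V₂) := Finite.of_equiv V e.toEquiv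
  refine MemC.of_iso (by omega) ?_ e.symm
  let κ : Bool → ℕ := fun b => cond b k₁ k₂
  have hκ : ∀ b, 0 < κ b := by rintro (_ | _) <;> assumption
  have hfib : ∀ b, ((G₁.joinGraph G₂).fiber Sum.isLeft b).MemC (κ b) := by
    rintro (_ | _)
    · exact hG₂.of_iso h₂ (nonempty_iso_fiber_joinGraph_false G₁ G₂).some
    · exact hG₁.of_iso h₁ (nonempty_iso_fiber_joinGraph_true G₁ G₂).some
  refine ⟨((isModularMap_joinGraph G₁ G₂).isCritical_iff (fun b => ?_) (by omega)).2
    ⟨κ, hκ, fun b => (hfib b).1, (weightCritical_top_bool_iff hκ).2 rfl⟩,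
    (isModularMap_joinGraph G₁ G₂).isP5CoP5Free isP5CoP5Free_top_bool fun b => (hfib b).2⟩
  obtain ⟨v⟩ := (hfib b).1.nonempty (hκ b)
  exact ⟨v.1, v.2⟩

theorem IsConstruction2.memC {V : Type u} [Finite V] {G : SimpleGraph V} {k : ℕ} (hk : 0 < k)
    (h : G.IsConstruction2 k) : G.MemC k := by
  obtain ⟨κ, W, B, hκ, hpair, hsum, hB, ⟨e⟩⟩ := h
  have hfin : Finite (Σ i, W i) := Finite.of_equiv V e.toEquiv
  refine MemC.of_iso hk ?_ e.symm
  have hmod : (buoy B).IsModularMap (cycleGraph 5) Sigma.fst := isModularMap_substitute _ B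
  have hfib : ∀ i, ((buoy B).fiber Sigma.fst i).MemC (κ i) := fun i =>
    (hB i).of_iso (hκ i) (nonempty_iso_fiber_substitute (cycleGraph 5) B i).some
  refine ⟨(hmod.isCritical_iff (fun i => ?_) hk).2 ⟨κ, hκ, fun i => (hfib i).1,
    (weightCritical_cycleGraph_five_iff hk hκ).2 ⟨hpair, hsum⟩⟩,
    hmod.isP5CoP5Free isP5CoP5Free_cycleGraph_five fun i => (hfib i).2⟩
  obtain ⟨v⟩ := (hfib i).1.nonempty (hκ i)
  exact ⟨v.1, v.2⟩

theorem IsP5CoP5Free.fiber {V I : Type*} {G : SimpleGraph V} (hG : G.IsP5CoP5Free) (f : V → I)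
    (i : I) : (G.fiber f i).IsP5CoP5Free :=
  hG.of_isIndContained ⟨Embedding.induce _⟩

theorem MemC.isConstruction1 {V : Type u} [Finite V] {G : SimpleGraph V} {k : ℕ} (hk : 0 < k)
    (hG : G.MemC k) {f : V → Bool} (hf : G.IsModularMap ⊤ f) (hs : Function.Surjective f) :
    G.IsConstruction1 k := by
  obtain ⟨κ, hκ, hcrit, hw⟩ := (hf.isCritical_iff hs hk).1 hG.1
  exact ⟨κ true, κ false, _, _, G.fiber f true, G.fiber f false, hκ _, hκ _,
    (weightCritical_top_bool_iff hκ).1 hw, ⟨hcrit _, hG.2.fiber f _⟩, ⟨hcrit _, hG.2.fiber f _⟩,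
    hf.nonempty_iso_joinGraph⟩

theorem MemC.isConstruction2 {V : Type u} [Finite V] {G : SimpleGraph V} {k : ℕ} (hk : 0 < k)
    (hG : G.MemC k) {f : V → Fin 5} (hf : G.IsModularMap (cycleGraph 5) f)
    (hs : Function.Surjective f) : G.IsConstruction2 k := by
  obtain ⟨κ, hκ, hcrit, hw⟩ := (hf.isCritical_iff hs hk).1 hG.1
  obtain ⟨hpair, hsum⟩ := (weightCritical_cycleGraph_five_iff hk hκ).1 hw
  exact ⟨κ, _, G.fiber f, hκ, hpair, hsum, fun i => ⟨hcrit i, hG.2.fiber f i⟩,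
    hf.nonempty_iso_substitute⟩

/-- If the weight is critical and the graph is perfect, then the graph is complete. -/
theorem IsP5CoP5Free.eq_top_of_weightCritical {I : Type*} [Finite I] [DecidableEq I]
    {Q : SimpleGraph I} (hQ : Q.IsP5CoP5Free) (h5 : ¬ (cycleGraph 5).IsIndContained Q)
    {κ : I → ℕ} {k : ℕ} (hk : 0 < k) (hw : Q.WeightCritical κ k) : Q = ⊤ := by
  obtain ⟨T, hT, hlt⟩ := hQ.exists_isClique_lt_sum h5 (κ := κ) (n := k - 1) fun h => by
    have := hw.2.1 _ h
    omega
  have huniv : ∀ i, i ∈ T := by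
    intro i
    by_contra hi
    have h1 := (hw.2.2 i).sum_le_of_isClique hT
    rw [Finset.sum_update_of_notMem hi] at h1
    omega
  ext i j
  exact ⟨fun h => h.ne, fun h => hT (huniv i) (huniv j) h⟩

theorem MemC.isConstruction1_or_isConstruction2 {V : Type u} [Finite V] {G : SimpleGraph V}
    {k : ℕ} (hk : 2 ≤ k) (hG : G.MemC k) : G.IsConstruction1 k ∨ G.IsConstruction2 k := by
  have hk0 : 0 < k := by omega
  have hnt : Nontrivial V := by
    by_contra h
    have := not_nontrivial_iff_subsingleton.1 h
    have h1 := G.chromaticNumber_le_one_of_subsingleton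
    rw [hG.1.1] at h1
    have : k ≤ 1 := by exact_mod_cast h1
    omega
  obtain ⟨n, Q, f, hn, hs, hf, hprime⟩ := G.exists_prime_quotient
  have hQ : Q.IsP5CoP5Free := hG.2.of_isIndContained (hf.isIndContained_of_surjective hs)
  by_cases h5 : (cycleGraph 5).IsIndContained Q
  · obtain ⟨g, hgs, hg⟩ := hprime.exists_modularMap_cycleGraph hQ h5
    exact Or.inr (hG.isConstruction2 hk0 (hg.comp hf) (hgs.comp hs))
  · left
    obtain ⟨κ, -, -, hw⟩ := (hf.isCritical_iff hs hk0).1 hG.1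
    obtain rfl := hQ.eq_top_of_weightCritical h5 hk0 hw
    -- A complete quotient with `n ≥ 2` parts splits as one part against the rest.
    let g : Fin n → Bool := fun i => decide (i = ⟨0, by omega⟩)
    have hg : (⊤ : SimpleGraph (Fin n)).IsModularMap ⊤ g := fun i j h =>
      iff_of_true (fun e => h (congrArg g e)) h
    have hgs : Function.Surjective g := by
      rintro (_ | _)
      · exact ⟨⟨1, by omega⟩, by simp [g]⟩
      · exact ⟨⟨0, by omega⟩, by simp [g]⟩
    exact hG.isConstruction1 hk0 (hg.comp hf) (hgs.comp hs)

end SimpleGraph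

theorem mainTheorem1 {V : Type u} [Finite V] (G : SimpleGraph V) (k : ℕ) (hk : 2 ≤ k) :
    G.MemC k ↔ (G.IsConstruction1 k ∨ G.IsConstruction2 k) :=
  ⟨fun h => h.isConstruction1_or_isConstruction2 hk,
    fun h => h.elim SimpleGraph.IsConstruction1.memC fun h => h.memC (by omega)⟩
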